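/- Let $\mathsf Z$ be a complete separable metric space with its Borel $\sigma$-field, and let $\mathrm Q$ be a Markov kernel on $\mathsf Z$ with a unique invariant probability measure $\pi$. Assume that for some integer $\tau\ge 1$, $$\tfrac12\,\|\mathrm Q^{n}(z,\cdot)-\pi\|_{\mathrm{TV}}\le (1/4)^{\lfloor n/\tau\rfloor}\qquad\text{for all } n\ge 0,\ z\in\mathsf Z,$$ where $\|\cdot\|_{\mathrm{TV}}$ is the total variation norm of signed measures (total mass of the variation). Let $f:\mathsf Z\to\mathbb R$ be measurable with $\sup_z|f(z)|\le 1$, and put $\bar f=f-\pi(f)$. Then the series in $$\sigma_\pi^2(f)=\pi(\bar f^{2})+2\sum_{\ell=1}^{\infty}\pi(\bar f\,\mathrm Q^{\ell}\bar f)$$ converges (absolutely) and $\sigma_\pi^2(f)\ge 0$; let $\sigma_\pi(f)$ be its nonnegative square root. Let $\mathbb P_\pi$ be the law of the Markov chain $(Z_k)_{k\ge 0}$ with kernel $\mathrm Q$ and initial distribution $\pi$, and let $\bar S_n=\sum_{i=0}^{n-1}\{f(Z_i)-\pi(f)\}$. Set $C_{\mathrm{Rm},1}=60\,\mathrm e$,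 $C_{\mathrm{Rm},2}=60$, $D_1=\tfrac{16}{3}\sqrt{19/3}\;C_{\mathrm{Rm},1}$, $D_2=\tfrac{64}{3}\bigl(C_{\mathrm{Rm},2}^{1/2}C_{\mathrm{Rm},1}^{2}+C_{\mathrm{Rm},2}\bigr)$ and $\widetilde{\ln}(s)=\ln(s)\,\log_2(2\ln s)$. Then for every integer $n\ge 0$ and every $\delta\in(0,1/2]$, $$\mathbb P_\pi\Bigl[\,|\bar S_n|\ \ge\ C_{\mathrm{Rm},1}\sqrt2\,\sqrt{n\ln(1/\delta)}\;\sigma_\pi(f)+D_1\,n^{1/4}\tau^{3/4}\,\widetilde{\ln}(1/\delta)+D_2\,\tau\,\widetilde{\ln}(1/\delta)\Bigr]\le\delta .$$ -/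

import Mathlib

open MeasureTheory ProbabilityTheory

noncomputable section

namespace MarkovBernstein

/-- The iterates of a Markov kernel (powers in the monoid of kernels) are Markov kernels. -/
instance isMarkovKernel_pow {Z : Type*} [MeasurableSpace Z] (Q : Kernel Z Z) [IsMarkovKernel Q]
    (n : ℕ) : IsMarkovKernel (Q ^ n) := by
  induction n with
  | zero =>
    rw [pow_zero]
    exact inferInstanceAs (IsMarkovKernel (Kernel.id : Kernel Z Z))
  | succ n ih =>
    rw [pow_succ]
    exact inferInstanceAs (IsMarkovKernel ((Q ^ n) ∘ₖ Q))

/-- The total variation norm `‖μ - ν‖_TV`: the total mass of the total variation measure of the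
signed measure `μ - ν` (so it equals `2` for mutually singular probability measures). -/
def tvNormSub {Z : Type*} [MeasurableSpace Z] (μ ν : Measure Z) [IsFiniteMeasure μ]
    [IsFiniteMeasure ν] : ℝ :=
  (μ.toSignedMeasure - ν.toSignedMeasure).totalVariation.real Set.univ

/-- `π` is the unique invariant probability measure of `Q`, and `Q` is uniformly geometrically
ergodic with mixing time `τ`. -/
structure IsUniformlyErgodic {Z : Type*} [MeasurableSpace Z] (Q : Kernel Z Z) [IsMarkovKernel Q]
    (π : Measure Z) [IsProbabilityMeasure π] (τ : ℕ) : Prop where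
  invariant : Q.Invariant π
  unique : ∀ ν : Measure Z, IsProbabilityMeasure ν → Q.Invariant ν → ν = π
  tau_pos : 0 < τ
  mixing : ∀ (n : ℕ) (z : Z), (1 / 2 : ℝ) * tvNormSub ((Q ^ n) z) π ≤ (1 / 4 : ℝ) ^ (n / τ)

/-- The step kernels of the homogeneous chain: given the past `z₀, …, zₙ`, the next state has law
`Q(zₙ, ·)`. -/
def stepKernel {Z : Type*} [MeasurableSpace Z] (Q : Kernel Z Z) (n : ℕ) :
    Kernel ((i : Finset.Iic n) → (fun _ : ℕ => Z) i) Z :=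
  Q.comap (fun x => x ⟨n, Finset.mem_Iic.2 le_rfl⟩) (measurable_pi_apply _)

instance isMarkovKernel_stepKernel {Z : Type*} [MeasurableSpace Z] (Q : Kernel Z Z)
    [IsMarkovKernel Q] (n : ℕ) : IsMarkovKernel (stepKernel Q n) :=
  inferInstanceAs (IsMarkovKernel (Q.comap _ _))

/-- The law `ℙ_ξ` on `Z^ℕ` of the canonical Markov chain with kernel `Q` and initial
distribution `ξ`. -/
def chainLaw {Z : Type*} [MeasurableSpace Z] (Q : Kernel Z Z) [IsMarkovKernel Q]
    (ξ : Measure Z) : Measure (ℕ → Z) :=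
  Kernel.trajMeasure (X := fun _ => Z) ξ (stepKernel Q)

/-- The centred function `f - π(f)`. -/
def centered {Z : Type*} [MeasurableSpace Z] (π : Measure Z) (f : Z → ℝ) : Z → ℝ :=
  fun z => f z - ∫ y, f y ∂π

/-- The centred additive functional `∑_{i < n} (f(Z_i) - π(f))` of a trajectory. -/
def centeredSum {Z : Type*} [MeasurableSpace Z] (π : Measure Z) (f : Z → ℝ) (n : ℕ)
    (ω : ℕ → Z) : ℝ :=
  ∑ i ∈ Finset.range n, centered π f (ω i)

/-- The stationary autocovariance `π(f̄ · Q^ℓ f̄)` at lag `ℓ`, with `f̄ = f - π(f)`. -/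
def autocov {Z : Type*} [MeasurableSpace Z] (Q : Kernel Z Z) (π : Measure Z) (f : Z → ℝ)
    (l : ℕ) : ℝ :=
  ∫ z, centered π f z * (∫ y, centered π f y ∂((Q ^ l) z)) ∂π

/-- The asymptotic variance `σ²_π(f) = π(f̄²) + 2 ∑_{ℓ ≥ 1} π(f̄ · Q^ℓ f̄)`. -/
def asympVar {Z : Type*} [MeasurableSpace Z] (Q : Kernel Z Z) (π : Measure Z) (f : Z → ℝ) : ℝ :=
  (∫ z, centered π f z ^ 2 ∂π) + 2 * ∑' l : ℕ, autocov Q π f (l + 1)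

/-- The first martingale Rosenthal constant, `60 e`. -/
def CRm1 : ℝ := 60 * Real.exp 1

/-- The second martingale Rosenthal constant, `60`. -/
def CRm2 : ℝ := 60

/-- `D₁ = (16/3) (19/3)^{1/2} C_{Rm,1}`. -/
def D1 : ℝ := 16 / 3 * Real.sqrt (19 / 3) * CRm1

/-- `D₂ = (64/3) (C_{Rm,2}^{1/2} C_{Rm,1}² + C_{Rm,2})`. -/
def D2 : ℝ := 64 / 3 * (Real.sqrt CRm2 * CRm1 ^ 2 + CRm2)

/-- `ln~(s) = ln(s) · log₂(2 ln(s))`. -/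
def lnTilde (s : ℝ) : ℝ := Real.log s * Real.logb 2 (2 * Real.log s)

end MarkovBernstein

end

/-!
Let `f̄ = f - π(f)` and let `g` solve the Poisson equation `g - Q g = f̄`. Along the chain,
`∑ f̄(Z_i)` is up to a bounded boundary term a martingale with increments `g(Z_{i+1}) - Q g(Z_i)`,
whose conditional variance `h` has stationary mean `σ²_π(f)`; in particular `σ²_π(f) ≥ 0`. A second
Poisson solution `G - Q G = h - σ²_π(f)` trades `h` for its mean: for `l` at most a constant over
the mixing time, `exp (l g + 3 l² G - 32 l⁴ G²)` is bounded above and below, and one step of the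
chain weighted by `exp (l f̄)` multiplies it by at most `exp (4 l² σ²_π(f))`. Iterating gives
`𝔼 exp (l S̄_n) ≤ exp (1 + 4 l² σ²_π(f) n)`, and Chernoff's bound gives a Bernstein inequality with
the exact asymptotic variance and a linear term of order `τ ln(1/δ)`. That is smaller than the
stated threshold, because `ln~` is at least `ln / 4` on `[2, ∞)`.
-/

namespace MarkovBernstein

section Mixing

variable {Z : Type*} [MeasurableSpace Z]

/-- The bounded measurable functions on which the kernels act, with an explicit uniform bound `C`
on `|φ|`. -/
structure IsBoundedMeasurable (φ : Z → ℝ) (C : ℝ) : Prop where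
  measurable : Measurable φ
  abs_le : ∀ z, |φ z| ≤ C

namespace IsBoundedMeasurable

variable {φ ψ : Z → ℝ} {C D : ℝ}

theorem mono (hφ : IsBoundedMeasurable φ C) (hCD : C ≤ D) : IsBoundedMeasurable φ D :=
  ⟨hφ.measurable, fun z => (hφ.abs_le z).trans hCD⟩

theorem const (c : ℝ) : IsBoundedMeasurable (fun _ : Z => c) |c| :=
  ⟨measurable_const, fun _ => le_rfl⟩

theorem add (hφ : IsBoundedMeasurable φ C) (hψ : IsBoundedMeasurable ψ D) :
    IsBoundedMeasurable (fun z => φ z + ψ z) (C + D) :=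
  ⟨hφ.measurable.add hψ.measurable,
    fun z => (abs_add_le _ _).trans (add_le_add (hφ.abs_le z) (hψ.abs_le z))⟩

theorem sub (hφ : IsBoundedMeasurable φ C) (hψ : IsBoundedMeasurable ψ D) :
    IsBoundedMeasurable (fun z => φ z - ψ z) (C + D) :=
  ⟨hφ.measurable.sub hψ.measurable,
    fun z => (abs_sub _ _).trans (add_le_add (hφ.abs_le z) (hψ.abs_le z))⟩

theorem mul (hφ : IsBoundedMeasurable φ C) (hψ : IsBoundedMeasurable ψ D) :
    IsBoundedMeasurable (fun z => φ z * ψ z) (C * D) := by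
  refine ⟨hφ.measurable.mul hψ.measurable, fun z => ?_⟩
  rw [abs_mul]
  exact mul_le_mul (hφ.abs_le z) (hψ.abs_le z) (abs_nonneg _) ((abs_nonneg _).trans (hφ.abs_le z))

theorem const_mul (hφ : IsBoundedMeasurable φ C) (c : ℝ) :
    IsBoundedMeasurable (fun z => c * φ z) (|c| * C) :=
  (const c).mul hφ

theorem pow (hφ : IsBoundedMeasurable φ C) (k : ℕ) :
    IsBoundedMeasurable (fun z => φ z ^ k) (C ^ k) := by
  refine ⟨hφ.measurable.pow_const k, fun z => ?_⟩
  rw [abs_pow]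
  exact pow_le_pow_left₀ (abs_nonneg _) (hφ.abs_le z) k

theorem exp (hφ : IsBoundedMeasurable φ C) :
    IsBoundedMeasurable (fun z => Real.exp (φ z)) (Real.exp C) := by
  refine ⟨Real.measurable_exp.comp hφ.measurable, fun z => ?_⟩
  rw [Real.abs_exp]
  exact Real.exp_le_exp.2 ((le_abs_self _).trans (hφ.abs_le z))

theorem memLp (hφ : IsBoundedMeasurable φ C) (p : ENNReal) (μ : Measure Z) [IsFiniteMeasure μ] :
    MemLp φ p μ :=
  MemLp.of_bound hφ.measurable.aestronglyMeasurable C (ae_of_all _ hφ.abs_le)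

theorem integrable (hφ : IsBoundedMeasurable φ C) (μ : Measure Z) [IsFiniteMeasure μ] :
    Integrable φ μ :=
  Integrable.of_bound hφ.measurable.aestronglyMeasurable C (ae_of_all _ hφ.abs_le)

theorem abs_integral_le (hφ : IsBoundedMeasurable φ C) (μ : Measure Z) [IsProbabilityMeasure μ] :
    |∫ z, φ z ∂μ| ≤ C := by
  simpa using norm_integral_le_of_norm_le_const (μ := μ) (f := φ) (ae_of_all _ hφ.abs_le)

theorem centered (hφ : IsBoundedMeasurable φ C) (π : Measure Z) [IsProbabilityMeasure π] :
    IsBoundedMeasurable (centered π φ) (2 * C) := by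
  refine ⟨hφ.measurable.sub_const _, fun z => ?_⟩
  calc |φ z - ∫ y, φ y ∂π| ≤ |φ z| + |∫ y, φ y ∂π| := abs_sub _ _
    _ ≤ 2 * C := by linarith [hφ.abs_le z, hφ.abs_integral_le π]

theorem centeredSum (hφ : IsBoundedMeasurable φ C) (π : Measure Z) [IsProbabilityMeasure π]
    (n : ℕ) : IsBoundedMeasurable (centeredSum π φ n) (n * (2 * C)) := by
  refine ⟨Finset.measurable_sum _ fun i _ =>
    (hφ.centered π).measurable.comp (measurable_pi_apply i), fun ω => ?_⟩
  calc |∑ i ∈ Finset.range n, MarkovBernstein.centered π φ (ω i)|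
      ≤ ∑ i ∈ Finset.range n, |MarkovBernstein.centered π φ (ω i)| :=
        Finset.abs_sum_le_sum_abs _ _
    _ ≤ n * (2 * C) := by
        simpa using Finset.sum_le_card_nsmul (Finset.range n) _ _
          fun i _ => (hφ.centered π).abs_le (ω i)

theorem integral_kernel (hφ : IsBoundedMeasurable φ C) {Y : Type*} [MeasurableSpace Y]
    (κ : Kernel Y Z) [IsMarkovKernel κ] : IsBoundedMeasurable (fun y => ∫ z, φ z ∂(κ y)) C :=
  ⟨(hφ.measurable.stronglyMeasurable.integral_kernel (κ := κ)).measurable,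
    fun y => hφ.abs_integral_le (κ y)⟩

theorem integral_pow_succ (hφ : IsBoundedMeasurable φ C) (Q : Kernel Z Z) [IsMarkovKernel Q]
    (k : ℕ) (z : Z) :
    ∫ y, φ y ∂((Q ^ (k + 1)) z) = ∫ w, ∫ y, φ y ∂((Q ^ k) w) ∂(Q z) := by
  have pow_eq : Q ^ (k + 1) = (Q ^ k) ∘ₖ Q := pow_succ Q k
  rw [pow_eq, Kernel.integral_comp (hφ.integrable (((Q ^ k) ∘ₖ Q) z))]

theorem integral_integral_of_invariant (hφ : IsBoundedMeasurable φ C) {Q : Kernel Z Z}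
    [IsMarkovKernel Q] {π : Measure Z} [IsProbabilityMeasure π] (hπ : Q.Invariant π) :
    ∫ z, ∫ y, φ y ∂(Q z) ∂π = ∫ z, φ z ∂π := by
  have comp_const_eq : (Q ∘ₖ Kernel.const Unit π) () = π := by
    rw [Kernel.comp_const, Kernel.const_apply, hπ.def]
  have h := Kernel.integral_comp (hφ.integrable ((Q ∘ₖ Kernel.const Unit π) ()))
  rwa [comp_const_eq, Kernel.const_apply, eq_comm] at h

theorem abs_integral_sub_integral_le (hφ : IsBoundedMeasurable φ C) (μ ν : Measure Z)
    [IsFiniteMeasure μ] [IsFiniteMeasure ν] :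
    |∫ z, φ z ∂μ - ∫ z, φ z ∂ν| ≤ C * tvNormSub μ ν := by
  have integrable_toSignedMeasure (ρ : Measure Z) [IsFiniteMeasure ρ] :
      ρ.toSignedMeasure.Integrable φ := by
    rw [VectorMeasure.Integrable, Measure.variation_toSignedMeasure]
    exact hφ.integrable ρ
  rw [tvNormSub, SignedMeasure.totalVariation_eq_variation,
    ← VectorMeasure.integral_toSignedMeasure, ← VectorMeasure.integral_toSignedMeasure,
    ← VectorMeasure.integral_sub_vectorMeasure (integrable_toSignedMeasure μ)
      (integrable_toSignedMeasure ν)]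
  have : IsFiniteMeasure (μ.toSignedMeasure - ν.toSignedMeasure).variation := by
    rw [← SignedMeasure.totalVariation_eq_variation]
    infer_instance
  simpa using VectorMeasure.norm_integral_le_of_norm_le_const
    (μ := μ.toSignedMeasure - ν.toSignedMeasure)
    (B := (ContinuousLinearMap.lsmul ℝ ℝ).flip) (f := φ) (ae_of_all _ hφ.abs_le)

end IsBoundedMeasurable

/-- `Q` converges in total variation, uniformly in the starting point, to its invariant law `π` at
a rate `β` that is summable with sum `B`. In the geometric case `B` is of the order of the mixing
time. -/
structure IsSummablyMixing (Q : Kernel Z Z) [IsMarkovKernel Q] (π : Measure Z)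
    [IsProbabilityMeasure π] (β : ℕ → ℝ) (B : ℝ) : Prop where
  invariant : Q.Invariant π
  tvNormSub_le : ∀ (k : ℕ) (z : Z), tvNormSub ((Q ^ k) z) π ≤ β k
  hasSum : HasSum β B

theorem hasSum_geometric_div {r : ℝ} (hr0 : 0 ≤ r) (hr1 : r < 1) {τ : ℕ} (hτ : 0 < τ) :
    HasSum (fun k : ℕ => r ^ (k / τ)) ((1 - r)⁻¹ * τ) := by
  have : NeZero τ := ⟨hτ.ne'⟩
  have quotients := hasSum_geometric_of_lt_one hr0 hr1
  have residues : HasSum (fun _ : Fin τ => (1 : ℝ)) τ := by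
    simpa using hasSum_fintype (fun _ : Fin τ => (1 : ℝ))
  have products := quotients.mul residues (quotients.summable.mul_of_nonneg residues.summable
    (fun _ => by positivity) (fun _ => zero_le_one))
  rw [← (Nat.divModEquiv τ).hasSum_iff] at products
  simpa [Function.comp_def, Nat.divModEquiv] using products

theorem IsUniformlyErgodic.isSummablyMixing {Q : Kernel Z Z} [IsMarkovKernel Q] {π : Measure Z}
    [IsProbabilityMeasure π] {τ : ℕ} (hQ : IsUniformlyErgodic Q π τ) :
    IsSummablyMixing Q π (fun k => 2 * (1 / 4) ^ (k / τ)) (8 / 3 * τ) where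
  invariant := hQ.invariant
  tvNormSub_le k z := by linarith [hQ.mixing k z]
  hasSum := by
    have h := (hasSum_geometric_div (r := 1 / 4) (by norm_num) (by norm_num) hQ.tau_pos).mul_left 2
    rwa [show (2 : ℝ) * ((1 - 1 / 4)⁻¹ * τ) = 8 / 3 * τ by ring] at h

end Mixing

theorem integral_pow_zero {Z : Type*} [MeasurableSpace Z] (Q : Kernel Z Z) {φ : Z → ℝ}
    (hφ : Measurable φ) (z : Z) : ∫ y, φ y ∂((Q ^ 0) z) = φ z := by
  have pow_zero_apply : (Q ^ 0) z = Measure.dirac z := by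
    rw [pow_zero]
    exact Kernel.id_apply z
  rw [pow_zero_apply, integral_dirac' _ _ hφ.stronglyMeasurable]

section Poisson

variable {Z : Type*} [MeasurableSpace Z] {Q : Kernel Z Z} [IsMarkovKernel Q] {π : Measure Z}
  [IsProbabilityMeasure π] {β : ℕ → ℝ} {B : ℝ} {φ ψ : Z → ℝ} {C D : ℝ}

/-- A solution `g = ∑ₖ Qᵏ(φ - π(φ))` of the Poisson equation `g - Q g = φ - π(φ)`; the value is
the junk `0` at points where the series diverges. -/
noncomputable def poisson (Q : Kernel Z Z) (π : Measure Z) (φ : Z → ℝ) (z : Z) : ℝ :=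
  ∑' k : ℕ, ∫ y, centered π φ y ∂((Q ^ k) z)

namespace IsSummablyMixing

theorem abs_integral_centered_le (hQ : IsSummablyMixing Q π β B) (hφ : IsBoundedMeasurable φ C)
    (k : ℕ) (z : Z) : |∫ y, centered π φ y ∂((Q ^ k) z)| ≤ C * β k := by
  have hC : 0 ≤ C := (abs_nonneg _).trans (hφ.abs_le z)
  have sub_eq : ∫ y, centered π φ y ∂((Q ^ k) z) = ∫ y, φ y ∂((Q ^ k) z) - ∫ y, φ y ∂π := by
    simp only [centered]
    rw [integral_sub (hφ.integrable _) (integrable_const _)]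
    simp
  rw [sub_eq]
  exact (hφ.abs_integral_sub_integral_le _ _).trans
    (mul_le_mul_of_nonneg_left (hQ.tvNormSub_le k z) hC)

theorem hasSum_poisson (hQ : IsSummablyMixing Q π β B) (hφ : IsBoundedMeasurable φ C) (z : Z) :
    HasSum (fun k => ∫ y, centered π φ y ∂((Q ^ k) z)) (poisson Q π φ z) :=
  (Summable.of_norm_bounded (hQ.hasSum.mul_left C).summable
    fun k => hQ.abs_integral_centered_le hφ k z).hasSum

theorem isBoundedMeasurable_poisson (hQ : IsSummablyMixing Q π β B)
    (hφ : IsBoundedMeasurable φ C) : IsBoundedMeasurable (poisson Q π φ) (C * B) where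
  measurable := by
    refine measurable_of_tendsto_metrizable (f := fun n z =>
        ∑ k ∈ Finset.range n, ∫ y, centered π φ y ∂((Q ^ k) z))
      (fun n => Finset.measurable_sum _ fun k _ => ?_)
      (tendsto_pi_nhds.2 fun z => (hQ.hasSum_poisson hφ z).tendsto_sum_nat)
    exact ((hφ.centered π).integral_kernel (Q ^ k)).measurable
  abs_le z := (hQ.hasSum_poisson hφ z).norm_le_of_bounded (hQ.hasSum.mul_left C)
    fun k => hQ.abs_integral_centered_le hφ k z

theorem hasSum_integral_mul_poisson (hQ : IsSummablyMixing Q π β B)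
    (hφ : IsBoundedMeasurable φ C) (hψ : IsBoundedMeasurable ψ D) (μ : Measure Z)
    [IsFiniteMeasure μ] :
    HasSum (fun k => ∫ z, ψ z * ∫ y, centered π φ y ∂((Q ^ k) z) ∂μ)
      (∫ z, ψ z * poisson Q π φ z ∂μ) := by
  refine hasSum_integral_of_dominated_convergence (fun k _ => D * (C * β k))
    (fun k => (hψ.mul ((hφ.centered π).integral_kernel (Q ^ k))).measurable.aestronglyMeasurable)
    (fun k => ae_of_all _ fun z => ?_) (ae_of_all _ fun _ => ?_) (integrable_const _)
    (ae_of_all _ fun z => (hQ.hasSum_poisson hφ z).mul_left _)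
  · rw [Real.norm_eq_abs, abs_mul]
    exact mul_le_mul (hψ.abs_le z) (hQ.abs_integral_centered_le hφ k z) (abs_nonneg _)
      ((abs_nonneg _).trans (hψ.abs_le z))
  · exact ((hQ.hasSum.mul_left C).mul_left D).summable

theorem integral_poisson (hQ : IsSummablyMixing Q π β B) (hφ : IsBoundedMeasurable φ C) (z : Z) :
    ∫ y, poisson Q π φ y ∂(Q z) = poisson Q π φ z - centered π φ z := by
  have shifted : HasSum (fun k => ∫ y, centered π φ y ∂((Q ^ (k + 1)) z))
      (∫ y, poisson Q π φ y ∂(Q z)) := by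
    simpa only [one_mul, (hφ.centered π).integral_pow_succ] using
      hQ.hasSum_integral_mul_poisson hφ (IsBoundedMeasurable.const 1) (Q z)
  have tail := (hasSum_nat_add_iff' 1).2 (hQ.hasSum_poisson hφ z)
  simp only [Finset.sum_range_one, integral_pow_zero _ (hφ.centered π).measurable] at tail
  exact shifted.unique tail

theorem hasSum_autocov (hQ : IsSummablyMixing Q π β B) (hφ : IsBoundedMeasurable φ C) :
    HasSum (autocov Q π φ) (∫ z, centered π φ z * poisson Q π φ z ∂π) :=
  hQ.hasSum_integral_mul_poisson hφ (hφ.centered π) π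

theorem summable_autocov_succ (hQ : IsSummablyMixing Q π β B) (hφ : IsBoundedMeasurable φ C) :
    Summable fun l => autocov Q π φ (l + 1) :=
  (summable_nat_add_iff 1).2 (hQ.hasSum_autocov hφ).summable

end IsSummablyMixing

end Poisson

section AsymptoticVariance

variable {Z : Type*} [MeasurableSpace Z] {Q : Kernel Z Z} [IsMarkovKernel Q] {π : Measure Z}
  [IsProbabilityMeasure π] {β : ℕ → ℝ} {B : ℝ} {f : Z → ℝ} {C : ℝ}

/-- The function `f̄ (g + Q g)`, where `g` solves the Poisson equation for `f`. By that equation it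
equals `g² - (Q g)²`, and it has mean `σ²_π(f)`; the product form keeps its bound linear in the
mixing constant. -/
noncomputable def varDensity (Q : Kernel Z Z) (π : Measure Z) (f : Z → ℝ) (z : Z) : ℝ :=
  centered π f z * (poisson Q π f z + ∫ y, poisson Q π f y ∂(Q z))

namespace IsSummablyMixing

theorem isBoundedMeasurable_varDensity (hQ : IsSummablyMixing Q π β B)
    (hf : IsBoundedMeasurable f C) :
    IsBoundedMeasurable (varDensity Q π f) (2 * C * (C * B + C * B)) :=
  have hg := hQ.isBoundedMeasurable_poisson hf
  (hf.centered π).mul (hg.add (hg.integral_kernel Q))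

theorem integral_varDensity (hQ : IsSummablyMixing Q π β B) (hf : IsBoundedMeasurable f C) :
    ∫ z, varDensity Q π f z ∂π = asympVar Q π f := by
  have hg := hQ.isBoundedMeasurable_poisson hf
  have autocov_zero : autocov Q π f 0 = ∫ z, centered π f z ^ 2 ∂π := by
    simp only [autocov, integral_pow_zero _ (hf.centered π).measurable, pow_two]
  have tsum_eq : autocov Q π f 0 + ∑' l, autocov Q π f (l + 1)
      = ∫ z, centered π f z * poisson Q π f z ∂π := by
    rw [← (hQ.hasSum_autocov hf).summable.tsum_eq_zero_add, (hQ.hasSum_autocov hf).tsum_eq]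
  calc ∫ z, varDensity Q π f z ∂π
      = ∫ z, (2 * (centered π f z * poisson Q π f z) - centered π f z ^ 2) ∂π := by
        refine integral_congr_ae (ae_of_all _ fun z => ?_)
        simp only [varDensity, hQ.integral_poisson hf]
        ring
    _ = 2 * ∫ z, centered π f z * poisson Q π f z ∂π - ∫ z, centered π f z ^ 2 ∂π := by
        rw [integral_sub ((((hf.centered π).mul hg).const_mul 2).integrable π)
          (((hf.centered π).pow 2).integrable π), integral_const_mul]
    _ = asympVar Q π f := by
        rw [asympVar, ← tsum_eq, autocov_zero]
        ring

theorem variance_poisson (hQ : IsSummablyMixing Q π β B) (hf : IsBoundedMeasurable f C) (z : Z) :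
    Var[poisson Q π f; Q z]
      = ∫ y, poisson Q π f y ^ 2 ∂(Q z) - poisson Q π f z ^ 2 + varDensity Q π f z := by
  rw [variance_eq_sub ((hQ.isBoundedMeasurable_poisson hf).memLp 2 (Q z)), varDensity,
    hQ.integral_poisson hf]
  simp only [Pi.pow_apply]
  ring

theorem integral_variance_poisson (hQ : IsSummablyMixing Q π β B)
    (hf : IsBoundedMeasurable f C) :
    ∫ z, Var[poisson Q π f; Q z] ∂π = asympVar Q π f := by
  have hg2 := (hQ.isBoundedMeasurable_poisson hf).pow 2
  simp only [hQ.variance_poisson hf]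
  rw [integral_add (((hg2.integral_kernel Q).sub hg2).integrable π)
      ((hQ.isBoundedMeasurable_varDensity hf).integrable π),
    integral_sub ((hg2.integral_kernel Q).integrable π) (hg2.integrable π),
    hg2.integral_integral_of_invariant hQ.invariant, hQ.integral_varDensity hf, sub_self, zero_add]

theorem asympVar_nonneg (hQ : IsSummablyMixing Q π β B) (hf : IsBoundedMeasurable f C) :
    0 ≤ asympVar Q π f := by
  rw [← hQ.integral_variance_poisson hf]
  exact integral_nonneg fun z => variance_nonneg _ _

end IsSummablyMixing

/-- A solution `G` of the Poisson equation `G - Q G = h - σ²_π(f)`, where `h z` is the variance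
under `Q z` of the solution `g` of the Poisson equation for `f`. It is `poisson Q π h` up to an
additive constant; since `h` and `varDensity` differ by `Q g² - g²`, this form is bounded by a
multiple of `(C * B) ^ 2` rather than `C ^ 2 * B ^ 3`. -/
noncomputable def condVarPoisson (Q : Kernel Z Z) (π : Measure Z) (f : Z → ℝ) (z : Z) : ℝ :=
  poisson Q π (varDensity Q π f) z - poisson Q π f z ^ 2

namespace IsSummablyMixing

theorem isBoundedMeasurable_condVarPoisson (hQ : IsSummablyMixing Q π β B)
    (hf : IsBoundedMeasurable f C) :
    IsBoundedMeasurable (condVarPoisson Q π f) (5 * (C * B) ^ 2) := by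
  have h := (hQ.isBoundedMeasurable_poisson (hQ.isBoundedMeasurable_varDensity hf)).sub
    ((hQ.isBoundedMeasurable_poisson hf).pow 2)
  rwa [show 2 * C * (C * B + C * B) * B + (C * B) ^ 2 = 5 * (C * B) ^ 2 by ring] at h

theorem integral_condVarPoisson (hQ : IsSummablyMixing Q π β B) (hf : IsBoundedMeasurable f C)
    (z : Z) :
    ∫ y, condVarPoisson Q π f y ∂(Q z)
      = condVarPoisson Q π f z - (Var[poisson Q π f; Q z] - asympVar Q π f) := by
  have hk := hQ.isBoundedMeasurable_varDensity hf
  simp only [condVarPoisson]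
  rw [integral_sub ((hQ.isBoundedMeasurable_poisson hk).integrable _)
      (((hQ.isBoundedMeasurable_poisson hf).pow 2).integrable _),
    hQ.integral_poisson hk, hQ.variance_poisson hf, centered, hQ.integral_varDensity hf]
  ring

end IsSummablyMixing

end AsymptoticVariance

section Lyapunov

theorem exp_add_sub_sq_le {x u q : ℝ} (hx : |x| ≤ 7 / 8) (hu : |u| ≤ 1 / 64) (hq : |q| ≤ 1 / 64) :
    Real.exp (x + 3 * (u - q) - 32 * (u ^ 2 - q ^ 2))
      ≤ 1 + x + 2 * x ^ 2 + (3 - 64 * q) * (u - q) := by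
  rw [abs_le] at hx hu hq
  set slope := 3 - 32 * (u + q) with hslope
  set y := x + slope * (u - q) with hy
  have slope_abs : |slope| ≤ 4 := abs_le.2 ⟨by linarith, by linarith⟩
  have increment_abs : |u - q| ≤ 1 / 32 := abs_le.2 ⟨by linarith, by linarith⟩
  have y_abs : |y| ≤ 1 := by
    have h := mul_le_mul slope_abs increment_abs (abs_nonneg _) (by norm_num)
    rw [← abs_mul, abs_le] at h
    exact abs_le.2 ⟨by linarith, by linarith⟩
  -- The exponent contains `-32 (u² - q²) = -64 q (u - q) - 32 (u - q)²` so that its square part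
  -- cancels the last term here.
  have y_sq : y ^ 2 ≤ 2 * x ^ 2 + 32 * (u - q) ^ 2 :=
    calc y ^ 2 ≤ 2 * (x ^ 2 + (slope * (u - q)) ^ 2) := add_sq_le
      _ ≤ 2 * x ^ 2 + 32 * (u - q) ^ 2 := by
        have slope_sq : slope ^ 2 ≤ 4 ^ 2 := sq_le_sq' (abs_le.1 slope_abs).1 (abs_le.1 slope_abs).2
        nlinarith [mul_le_mul_of_nonneg_right slope_sq (sq_nonneg (u - q))]
  have taylor : Real.exp y ≤ 1 + y + y ^ 2 := by
    linarith [(abs_le.1 (Real.abs_exp_sub_one_sub_id_le y_abs)).2]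
  calc Real.exp (x + 3 * (u - q) - 32 * (u ^ 2 - q ^ 2)) = Real.exp y := by
        congr 1
        rw [hy, hslope]
        ring
    _ ≤ 1 + y + (2 * x ^ 2 + 32 * (u - q) ^ 2) := by linarith
    _ = 1 + x + 2 * x ^ 2 + (3 - 64 * q) * (u - q) := by
        rw [hy, hslope]
        ring

variable {Z : Type*} [MeasurableSpace Z]

theorem integral_exp_add_sub_sq_le {ν : Measure Z} [IsProbabilityMeasure ν] {X U : Z → ℝ}
    {q s : ℝ} (hX : IsBoundedMeasurable X (7 / 8)) (hU : IsBoundedMeasurable U (1 / 64))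
    (hq : |q| ≤ 1 / 64) (hs : 0 ≤ s) (hX_mean : ∫ y, X y ∂ν = 0)
    (hU_mean : ∫ y, U y ∂ν = q - (∫ y, X y ^ 2 ∂ν - s)) :
    ∫ y, Real.exp (X y + 3 * (U y - q) - 32 * (U y ^ 2 - q ^ 2)) ∂ν ≤ Real.exp (4 * s) := by
  have hX2 := hX.pow 2
  have hUq := hU.sub (.const q)
  have hbound := (((IsBoundedMeasurable.const 1).add hX).add (hX2.const_mul 2)).add
    (hUq.const_mul (3 - 64 * q))
  have integral_bound : ∫ y, (1 + X y + 2 * X y ^ 2 + (3 - 64 * q) * (U y - q)) ∂ν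
      = 1 + 2 * ∫ y, X y ^ 2 ∂ν + (3 - 64 * q) * (s - ∫ y, X y ^ 2 ∂ν) := by
    rw [integral_add ((((IsBoundedMeasurable.const 1).add hX).add (hX2.const_mul 2)).integrable ν)
        ((hUq.const_mul _).integrable ν),
      integral_add (((IsBoundedMeasurable.const 1).add hX).integrable ν)
        ((hX2.const_mul 2).integrable ν),
      integral_add (integrable_const 1) (hX.integrable ν), integral_const_mul, integral_const_mul,
      integral_sub (hU.integrable ν) (integrable_const q), hX_mean, hU_mean]
    simp
  have hX2_nonneg : 0 ≤ ∫ y, X y ^ 2 ∂ν := integral_nonneg fun y => sq_nonneg _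
  rw [abs_le] at hq
  calc ∫ y, Real.exp (X y + 3 * (U y - q) - 32 * (U y ^ 2 - q ^ 2)) ∂ν
      ≤ ∫ y, (1 + X y + 2 * X y ^ 2 + (3 - 64 * q) * (U y - q)) ∂ν :=
        integral_mono_of_nonneg (ae_of_all _ fun y => (Real.exp_pos _).le) (hbound.integrable ν)
          (ae_of_all _ fun y => exp_add_sub_sq_le (hX.abs_le y) (hU.abs_le y) (abs_le.2 hq))
    _ ≤ 4 * s + 1 := by
        rw [integral_bound]
        nlinarith
    _ ≤ Real.exp (4 * s) := Real.add_one_le_exp _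

/-- The exponent of the Lyapunov function `exp (l g + 3 l² G - 32 l⁴ G²)`, where `g` and `G` are
the two Poisson solutions. The linear term in `G` turns the conditional variance of `g` into its
stationary mean `σ²_π(f)`, and the quadratic one pays for the fluctuations of `G`. -/
noncomputable def lyapunov (Q : Kernel Z Z) (π : Measure Z) (f : Z → ℝ) (l : ℝ) (z : Z) : ℝ :=
  l * poisson Q π f z + 3 * (l ^ 2 * condVarPoisson Q π f z)
    - 32 * (l ^ 2 * condVarPoisson Q π f z) ^ 2

namespace IsSummablyMixing

variable {Q : Kernel Z Z} [IsMarkovKernel Q] {π : Measure Z} [IsProbabilityMeasure π] {β : ℕ → ℝ}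
  {B : ℝ} {f : Z → ℝ} {C l : ℝ}

theorem isBoundedMeasurable_mul_poisson (hQ : IsSummablyMixing Q π β B)
    (hf : IsBoundedMeasurable f C) (hl : |l| * (C * B) ≤ 1 / 18) :
    IsBoundedMeasurable (fun z => l * poisson Q π f z) (1 / 18) :=
  ((hQ.isBoundedMeasurable_poisson hf).const_mul l).mono hl

theorem isBoundedMeasurable_sq_mul_condVarPoisson (hQ : IsSummablyMixing Q π β B)
    (hf : IsBoundedMeasurable f C) (hCB : 0 ≤ C * B) (hl : |l| * (C * B) ≤ 1 / 18) :
    IsBoundedMeasurable (fun z => l ^ 2 * condVarPoisson Q π f z) (1 / 64) := by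
  refine ((hQ.isBoundedMeasurable_condVarPoisson hf).const_mul (l ^ 2)).mono ?_
  calc |l ^ 2| * (5 * (C * B) ^ 2) = 5 * (|l| * (C * B)) ^ 2 := by
        rw [abs_pow]
        ring
    _ ≤ 5 * (1 / 18) ^ 2 := by gcongr
    _ ≤ 1 / 64 := by norm_num

theorem isBoundedMeasurable_lyapunov (hQ : IsSummablyMixing Q π β B)
    (hf : IsBoundedMeasurable f C) (hCB : 0 ≤ C * B) (hl : |l| * (C * B) ≤ 1 / 18) :
    IsBoundedMeasurable (lyapunov Q π f l) (1 / 2) := by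
  have hG := hQ.isBoundedMeasurable_sq_mul_condVarPoisson hf hCB hl
  refine (((hQ.isBoundedMeasurable_mul_poisson hf hl).add (hG.const_mul 3)).sub
    ((hG.pow 2).const_mul 32)).mono ?_
  norm_num

theorem lyapunov_eq_add_increment (hQ : IsSummablyMixing Q π β B)
    (hf : IsBoundedMeasurable f C) (z y : Z) :
    lyapunov Q π f l y = lyapunov Q π f l z - l * centered π f z
      + (l * (poisson Q π f y - ∫ w, poisson Q π f w ∂(Q z))
        + 3 * (l ^ 2 * condVarPoisson Q π f y - l ^ 2 * condVarPoisson Q π f z)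
        - 32 * ((l ^ 2 * condVarPoisson Q π f y) ^ 2 - (l ^ 2 * condVarPoisson Q π f z) ^ 2)) := by
  rw [hQ.integral_poisson hf, lyapunov, lyapunov]
  ring

theorem exp_mul_integral_exp_lyapunov_le (hQ : IsSummablyMixing Q π β B)
    (hf : IsBoundedMeasurable f C) (hCB : 0 ≤ C * B) (hl : |l| * (C * B) ≤ 1 / 18) (z : Z) :
    Real.exp (l * centered π f z) * ∫ y, Real.exp (lyapunov Q π f l y) ∂(Q z)
      ≤ Real.exp (4 * (l ^ 2 * asympVar Q π f)) * Real.exp (lyapunov Q π f l z) := by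
  set m := ∫ y, poisson Q π f y ∂(Q z) with hm
  set q := l ^ 2 * condVarPoisson Q π f z
  have hg := hQ.isBoundedMeasurable_poisson hf
  have hG := hQ.isBoundedMeasurable_sq_mul_condVarPoisson hf hCB hl
  have hX : IsBoundedMeasurable (fun y => l * (poisson Q π f y - m)) (7 / 8) := by
    refine ((hg.sub (.const m)).const_mul l).mono ?_
    have hm_le : |m| ≤ C * B := hg.abs_integral_le (Q z)
    nlinarith [mul_le_mul_of_nonneg_left hm_le (abs_nonneg l)]
  have hX_mean : ∫ y, l * (poisson Q π f y - m) ∂(Q z) = 0 := by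
    rw [integral_const_mul, integral_sub (hg.integrable _) (integrable_const m)]
    simp [hm]
  have hX_sq : ∫ y, (l * (poisson Q π f y - m)) ^ 2 ∂(Q z) = l ^ 2 * Var[poisson Q π f; Q z] := by
    simp only [mul_pow]
    rw [integral_const_mul, variance_eq_integral hg.measurable.aemeasurable]
  have hU_mean : ∫ y, l ^ 2 * condVarPoisson Q π f y ∂(Q z)
      = q - (∫ y, (l * (poisson Q π f y - m)) ^ 2 ∂(Q z) - l ^ 2 * asympVar Q π f) := by
    rw [hX_sq, integral_const_mul, hQ.integral_condVarPoisson hf]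
    ring
  have drift (y : Z) : Real.exp (lyapunov Q π f l y)
      = Real.exp (lyapunov Q π f l z - l * centered π f z)
        * Real.exp (l * (poisson Q π f y - m) + 3 * (l ^ 2 * condVarPoisson Q π f y - q)
          - 32 * ((l ^ 2 * condVarPoisson Q π f y) ^ 2 - q ^ 2)) := by
    rw [← Real.exp_add, hQ.lyapunov_eq_add_increment hf z y]
  rw [integral_congr_ae (ae_of_all _ drift), integral_const_mul, ← mul_assoc,
    ← Real.exp_add, add_sub_cancel, mul_comm]
  gcongr
  exact integral_exp_add_sub_sq_le hX hG (hG.abs_le z)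
    (mul_nonneg (sq_nonneg l) (hQ.asympVar_nonneg hf)) hX_mean hU_mean

end IsSummablyMixing

end Lyapunov

section Chain

variable {Z : Type*} [MeasurableSpace Z] {Q : Kernel Z Z} [IsMarkovKernel Q] {ξ : Measure Z}
  [IsProbabilityMeasure ξ]

instance isProbabilityMeasure_chainLaw : IsProbabilityMeasure (chainLaw Q ξ) :=
  inferInstanceAs (IsProbabilityMeasure (Kernel.trajMeasure (X := fun _ => Z) ξ (stepKernel Q)))

theorem lintegral_chainLaw_succ (n : ℕ) {F : (Finset.Iic n → Z) × Z → ENNReal}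
    (hF : Measurable F) :
    ∫⁻ ω, F (Preorder.frestrictLe n ω, ω (n + 1)) ∂(chainLaw Q ξ)
      = ∫⁻ ω, ∫⁻ y, F (Preorder.frestrictLe n ω, y) ∂(Q (ω n)) ∂(chainLaw Q ξ) := by
  have past_measurable : Measurable (Preorder.frestrictLe (π := fun _ : ℕ => Z) n) :=
    Preorder.measurable_frestrictLe n
  have past_next_law := Kernel.map_frestrictLe_trajMeasure_compProd_eq_map_trajMeasure
    (X := fun _ => Z) (μ₀ := ξ) (κ := stepKernel Q) (a := n)
  calc ∫⁻ ω, F (Preorder.frestrictLe n ω, ω (n + 1)) ∂(chainLaw Q ξ)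
      = ∫⁻ p, F p ∂((chainLaw Q ξ).map fun ω => (Preorder.frestrictLe n ω, ω (n + 1))) :=
        (lintegral_map hF (past_measurable.prodMk (measurable_pi_apply (n + 1)))).symm
    _ = ∫⁻ x, ∫⁻ y, F (x, y) ∂(stepKernel Q n x)
          ∂((chainLaw Q ξ).map (Preorder.frestrictLe n)) := by
        rw [chainLaw, ← past_next_law, Measure.lintegral_compProd hF]
    _ = ∫⁻ ω, ∫⁻ y, F (Preorder.frestrictLe n ω, y) ∂(Q (ω n)) ∂(chainLaw Q ξ) :=
        lintegral_map hF.lintegral_kernel_prod_right' past_measurable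

theorem lintegral_prod_mul_chainLaw_le {w W : Z → ENNReal} (hw : Measurable w)
    (hW : Measurable W) {c : ENNReal} (drift : ∀ z, w z * ∫⁻ y, W y ∂(Q z) ≤ c * W z) (n : ℕ) :
    ∫⁻ ω, (∏ i ∈ Finset.range n, w (ω i)) * W (ω n) ∂(chainLaw Q ξ)
      ≤ c ^ n * ∫⁻ ω, W (ω 0) ∂(chainLaw Q ξ) := by
  induction n with
  | zero => simp
  | succ n ih =>
    have hF : Measurable fun p : (Finset.Iic n → Z) × Z => (∏ i, w (p.1 i)) * W p.2 := by
      fun_prop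
    have prod_past (ω : ℕ → Z) : ∏ i, w (Preorder.frestrictLe (π := fun _ : ℕ => Z) n ω i)
        = ∏ i ∈ Finset.range (n + 1), w (ω i) := by
      rw [Nat.range_succ_eq_Iic, ← Finset.prod_coe_sort (Finset.Iic n) fun i => w (ω i)]
      rfl
    calc ∫⁻ ω, (∏ i ∈ Finset.range (n + 1), w (ω i)) * W (ω (n + 1)) ∂(chainLaw Q ξ)
        = ∫⁻ ω, ∫⁻ y, (∏ i ∈ Finset.range (n + 1), w (ω i)) * W y ∂(Q (ω n))
            ∂(chainLaw Q ξ) := by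
          simpa only [prod_past] using lintegral_chainLaw_succ (Q := Q) (ξ := ξ) n hF
      _ = ∫⁻ ω, (∏ i ∈ Finset.range n, w (ω i)) * (w (ω n) * ∫⁻ y, W y ∂(Q (ω n)))
            ∂(chainLaw Q ξ) := by
          simp only [lintegral_const_mul _ hW]
          simp only [Finset.prod_range_succ, mul_assoc]
      _ ≤ ∫⁻ ω, (∏ i ∈ Finset.range n, w (ω i)) * (c * W (ω n)) ∂(chainLaw Q ξ) :=
          lintegral_mono fun ω => mul_le_mul' le_rfl (drift (ω n))
      _ = c * ∫⁻ ω, (∏ i ∈ Finset.range n, w (ω i)) * W (ω n) ∂(chainLaw Q ξ) := by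
          rw [← lintegral_const_mul _ (by fun_prop)]
          simp only [mul_left_comm]
      _ ≤ c ^ (n + 1) * ∫⁻ ω, W (ω 0) ∂(chainLaw Q ξ) := by
          rw [pow_succ', mul_assoc]
          gcongr

theorem lintegral_prod_chainLaw_le {w W : Z → ENNReal} (hw : Measurable w) (hW : Measurable W)
    {a c : ENNReal} (drift : ∀ z, w z * ∫⁻ y, W y ∂(Q z) ≤ c * W z) (one_le : ∀ z, 1 ≤ a * W z)
    (W_le : ∀ z, W z ≤ a) (n : ℕ) :
    ∫⁻ ω, ∏ i ∈ Finset.range n, w (ω i) ∂(chainLaw Q ξ) ≤ a * (c ^ n * a) :=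
  calc ∫⁻ ω, ∏ i ∈ Finset.range n, w (ω i) ∂(chainLaw Q ξ)
      ≤ ∫⁻ ω, a * ((∏ i ∈ Finset.range n, w (ω i)) * W (ω n)) ∂(chainLaw Q ξ) := by
        gcongr with ω
        rw [mul_left_comm]
        exact le_mul_of_one_le_right' (one_le (ω n))
    _ ≤ a * (c ^ n * ∫⁻ ω, W (ω 0) ∂(chainLaw Q ξ)) := by
        rw [lintegral_const_mul _ (by fun_prop)]
        gcongr
        exact lintegral_prod_mul_chainLaw_le hw hW drift n
    _ ≤ a * (c ^ n * ∫⁻ _, a ∂(chainLaw Q ξ)) := by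
        gcongr with ω
        exact W_le (ω 0)
    _ = a * (c ^ n * a) := by rw [lintegral_const, measure_univ, mul_one]

end Chain

section Bernstein

variable {Z : Type*} [MeasurableSpace Z] {Q : Kernel Z Z} [IsMarkovKernel Q] {π ξ : Measure Z}
  [IsProbabilityMeasure π] [IsProbabilityMeasure ξ] {β : ℕ → ℝ} {B : ℝ} {f : Z → ℝ} {C : ℝ}

theorem IsSummablyMixing.lintegral_exp_centeredSum_le (hQ : IsSummablyMixing Q π β B)
    (hf : IsBoundedMeasurable f C) (hCB : 0 ≤ C * B) {l : ℝ} (hl : |l| * (C * B) ≤ 1 / 18)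
    (n : ℕ) :
    ∫⁻ ω, ENNReal.ofReal (Real.exp (l * centeredSum π f n ω)) ∂(chainLaw Q ξ)
      ≤ ENNReal.ofReal (Real.exp (1 + 4 * (l ^ 2 * asympVar Q π f) * n)) := by
  have hV := hQ.isBoundedMeasurable_lyapunov hf hCB hl
  set w := fun z => ENNReal.ofReal (Real.exp (l * centered π f z)) with hw
  set W := fun z => ENNReal.ofReal (Real.exp (lyapunov Q π f l z)) with hW
  set c := ENNReal.ofReal (Real.exp (4 * (l ^ 2 * asympVar Q π f))) with hc
  set a := ENNReal.ofReal (Real.exp (1 / 2)) with ha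
  have drift (z : Z) : w z * ∫⁻ y, W y ∂(Q z) ≤ c * W z := by
    rw [← ofReal_integral_eq_lintegral_ofReal (hV.exp.integrable (Q z))
      (ae_of_all _ fun y => (Real.exp_pos _).le), hw, hc, hW,
      ← ENNReal.ofReal_mul (Real.exp_pos _).le, ← ENNReal.ofReal_mul (Real.exp_pos _).le]
    exact ENNReal.ofReal_le_ofReal (hQ.exp_mul_integral_exp_lyapunov_le hf hCB hl z)
  have one_le (z : Z) : 1 ≤ a * W z := by
    rw [ha, hW, ← ENNReal.ofReal_mul (Real.exp_pos _).le, ← Real.exp_add, ENNReal.one_le_ofReal,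
      Real.one_le_exp_iff]
    linarith [(abs_le.1 (hV.abs_le z)).1]
  have W_le (z : Z) : W z ≤ a :=
    ENNReal.ofReal_le_ofReal (Real.exp_le_exp.2 (abs_le.1 (hV.abs_le z)).2)
  have hw_meas : Measurable w :=
    ENNReal.measurable_ofReal.comp ((hf.centered π).const_mul l).exp.measurable
  have hW_meas : Measurable W := ENNReal.measurable_ofReal.comp hV.exp.measurable
  calc ∫⁻ ω, ENNReal.ofReal (Real.exp (l * centeredSum π f n ω)) ∂(chainLaw Q ξ)
      = ∫⁻ ω, ∏ i ∈ Finset.range n, w (ω i) ∂(chainLaw Q ξ) := by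
        simp only [hw, ← ENNReal.ofReal_prod_of_nonneg fun _ _ => (Real.exp_pos _).le,
          ← Real.exp_sum, ← Finset.mul_sum, centeredSum]
    _ ≤ a * (c ^ n * a) := lintegral_prod_chainLaw_le hw_meas hW_meas drift one_le W_le n
    _ = ENNReal.ofReal (Real.exp (1 + 4 * (l ^ 2 * asympVar Q π f) * n)) := by
        rw [ha, hc, ← ENNReal.ofReal_pow (Real.exp_pos _).le, ← ENNReal.ofReal_mul (by positivity),
          ← ENNReal.ofReal_mul (Real.exp_pos _).le, ← Real.exp_nat_mul, ← Real.exp_add,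
          ← Real.exp_add]
        congr 2
        ring

theorem IsSummablyMixing.mgf_centeredSum_le (hQ : IsSummablyMixing Q π β B)
    (hf : IsBoundedMeasurable f C) (hCB : 0 ≤ C * B) {l : ℝ} (hl : |l| * (C * B) ≤ 1 / 18)
    (n : ℕ) :
    mgf (centeredSum π f n) (chainLaw Q ξ) l
      ≤ Real.exp (1 + 4 * (l ^ 2 * asympVar Q π f) * n) := by
  rw [mgf, integral_eq_lintegral_of_nonneg_ae (ae_of_all _ fun ω => (Real.exp_pos _).le)
    ((hf.centeredSum π n).const_mul l).exp.measurable.aestronglyMeasurable]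
  exact ENNReal.toReal_le_of_le_ofReal (Real.exp_pos _).le
    (hQ.lintegral_exp_centeredSum_le hf hCB hl n)

theorem measureReal_le_abs_le_of_mgf_le {Ω : Type*} [MeasurableSpace Ω] {μ : Measure Ω}
    [IsFiniteMeasure μ] {X : Ω → ℝ} {l M : ℝ} (hl : 0 ≤ l)
    (int_pos : Integrable (fun ω => Real.exp (l * X ω)) μ)
    (int_neg : Integrable (fun ω => Real.exp (-l * X ω)) μ)
    (mgf_pos : mgf X μ l ≤ M) (mgf_neg : mgf X μ (-l) ≤ M) (x : ℝ) :
    μ.real {ω | x ≤ |X ω|} ≤ 2 * (M * Real.exp (-l * x)) := by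
  have upper : μ.real {ω | x ≤ X ω} ≤ M * Real.exp (-l * x) := by
    refine (measure_ge_le_exp_mul_mgf x hl int_pos).trans ?_
    rw [mul_comm]
    gcongr
  have lower : μ.real {ω | X ω ≤ -x} ≤ M * Real.exp (-l * x) := by
    refine (measure_le_le_exp_mul_mgf (-x) (neg_nonpos.2 hl) int_neg).trans ?_
    rw [mul_comm, neg_neg, mul_neg, ← neg_mul]
    gcongr
  calc μ.real {ω | x ≤ |X ω|} = μ.real ({ω | x ≤ X ω} ∪ {ω | X ω ≤ -x}) := by
        congr 1
        ext ω
        simp only [Set.mem_union, Set.mem_ofPred_eq, le_abs', or_comm]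
    _ ≤ 2 * (M * Real.exp (-l * x)) := by
        linarith [measureReal_union_le (μ := μ) {ω | x ≤ X ω} {ω | X ω ≤ -x}]

theorem exists_chernoff_parameter {A T u x : ℝ} (hA : 0 ≤ A) (hT : 0 < T) (hu : 0 < u)
    (hx : 8 * √u * A + 144 * T * u ≤ x) :
    ∃ l, 0 ≤ l ∧ l * T ≤ 1 / 18 ∧ 4 * (l * A) ^ 2 - l * x ≤ -4 * u := by
  have sq_sqrt : √u ^ 2 = u := Real.sq_sqrt hu.le
  rcases lt_or_ge A (18 * T * √u) with bounded_regime | gaussian_regime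
  · refine ⟨1 / (18 * T), by positivity, by field_simp; rfl, ?_⟩
    have hlA : 1 / (18 * T) * A ≤ √u := by
      rw [one_div_mul_eq_div, div_le_iff₀ (by positivity)]
      linarith
    have hlx : 8 * u ≤ 1 / (18 * T) * x := by
      rw [one_div_mul_eq_div, le_div_iff₀ (by positivity)]
      linarith [mul_nonneg (Real.sqrt_nonneg u) hA]
    have := pow_le_pow_left₀ (by positivity) hlA 2
    linarith
  · have hA_pos : 0 < A := lt_of_lt_of_le (by positivity) gaussian_regime
    refine ⟨√u / A, by positivity, ?_, ?_⟩
    · rw [div_mul_eq_mul_div, div_le_iff₀ hA_pos]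
      linarith
    · have hlx : 8 * u ≤ √u / A * x := by
        rw [div_mul_eq_mul_div, le_div_iff₀ hA_pos]
        calc 8 * u * A = √u * (8 * √u * A) := by linear_combination -8 * A * sq_sqrt
          _ ≤ √u * x := by
            gcongr
            linarith [mul_pos hT hu]
      rw [div_mul_cancel₀ _ hA_pos.ne', sq_sqrt]
      linarith

theorem IsSummablyMixing.bernstein (hQ : IsSummablyMixing Q π β B)
    (hf : IsBoundedMeasurable f C) (hCB : 0 < C * B) (n : ℕ) {u : ℝ} (hu : 0 < u) :
    (chainLaw Q ξ).real {ω | 8 * √(n * u) * √(asympVar Q π f) + 144 * (C * B) * u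
        ≤ |centeredSum π f n ω|} ≤ 2 * Real.exp (1 - 4 * u) := by
  set v := asympVar Q π f
  set x := 8 * √(n * u) * √v + 144 * (C * B) * u with hx
  obtain ⟨l, l_nonneg, l_small, exponent_le⟩ := exists_chernoff_parameter (A := √n * √v) (x := x)
    (by positivity) hCB hu (by rw [hx, Real.sqrt_mul n.cast_nonneg]; apply le_of_eq; ring)
  have hS := hf.centeredSum π n
  have mgf_le (t : ℝ) (ht : |t| = l) : mgf (centeredSum π f n) (chainLaw Q ξ) t
      ≤ Real.exp (1 + 4 * (l * (√n * √v)) ^ 2) := by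
    refine (hQ.mgf_centeredSum_le hf hCB.le (ht.symm ▸ l_small) n).trans_eq ?_
    rw [mul_pow, mul_pow, Real.sq_sqrt n.cast_nonneg, Real.sq_sqrt (hQ.asympVar_nonneg hf), ← ht,
      sq_abs]
    congr 1
    ring
  calc _ ≤ 2 * (Real.exp (1 + 4 * (l * (√n * √v)) ^ 2) * Real.exp (-l * x)) :=
        measureReal_le_abs_le_of_mgf_le l_nonneg ((hS.const_mul l).exp.integrable _)
          ((hS.const_mul (-l)).exp.integrable _) (mgf_le l (abs_of_nonneg l_nonneg))
          (mgf_le (-l) (by rw [abs_neg, abs_of_nonneg l_nonneg])) x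
    _ ≤ 2 * Real.exp (1 - 4 * u) := by
        rw [← Real.exp_add]
        gcongr
        linarith

end Bernstein

section Constants

theorem log_two_le_log_one_div {δ : ℝ} (hδ : 0 < δ) (hδ2 : δ ≤ 1 / 2) :
    Real.log 2 ≤ Real.log (1 / δ) :=
  Real.log_le_log two_pos ((le_one_div two_pos hδ).2 hδ2)

theorem two_mul_exp_one_sub_le {δ : ℝ} (hδ : 0 < δ) (hδ2 : δ ≤ 1 / 2) :
    2 * Real.exp (1 - 4 * Real.log (1 / δ)) ≤ δ := by
  calc 2 * Real.exp (1 - 4 * Real.log (1 / δ))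
      = Real.exp (Real.log 2 + (1 - 4 * Real.log (1 / δ))) := by
        rw [Real.exp_add, Real.exp_log two_pos]
    _ ≤ Real.exp (-Real.log (1 / δ)) := by
        gcongr
        linarith [log_two_le_log_one_div hδ hδ2, Real.log_two_gt_d9]
    _ = δ := by rw [one_div, Real.log_inv, neg_neg, Real.exp_log hδ]

theorem log_div_four_le_lnTilde {s : ℝ} (hs : 2 ≤ s) : Real.log s / 4 ≤ lnTilde s := by
  have log_two_le : Real.log 2 ≤ Real.log s := Real.log_le_log two_pos hs
  have two_log_ge : 4 / 3 ≤ 2 * Real.log s := by linarith [Real.log_two_gt_d9]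
  have log_ge : 1 / 4 ≤ Real.log (2 * Real.log s) := by
    have := Real.one_sub_inv_le_log_of_pos (show 0 < 2 * Real.log s by linarith)
    have := inv_anti₀ (by norm_num) two_log_ge
    linarith
  have logb_ge : 1 / 4 ≤ Real.logb 2 (2 * Real.log s) := by
    rw [Real.logb, le_div_iff₀ (Real.log_pos one_lt_two)]
    linarith [Real.log_two_lt_d9]
  rw [lnTilde]
  nlinarith

theorem sixty_le_CRm1 : 60 ≤ CRm1 := by
  rw [CRm1]
  linarith [Real.one_le_exp zero_le_one]

theorem le_D2 : 76800 ≤ D2 := by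
  have one_le_sqrt : 1 ≤ √CRm2 := Real.one_le_sqrt.2 (by norm_num [CRm2])
  have sq_le : 3600 ≤ CRm1 ^ 2 := by nlinarith [sixty_le_CRm1]
  have := mul_le_mul one_le_sqrt sq_le (by norm_num) (by positivity)
  rw [D2, show CRm2 = 60 from rfl] at *
  linarith

theorem bernstein_threshold_le {δ : ℝ} (hδ : 0 < δ) (hδ2 : δ ≤ 1 / 2) (n τ : ℕ) (v : ℝ) :
    8 * √(n * Real.log (1 / δ)) * √v + 144 * (1 * (8 / 3 * τ)) * Real.log (1 / δ)
      ≤ CRm1 * √2 * √(n * Real.log (1 / δ)) * √v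
        + D1 * (n : ℝ) ^ (1 / 4 : ℝ) * (τ : ℝ) ^ (3 / 4 : ℝ) * lnTilde (1 / δ)
        + D2 * τ * lnTilde (1 / δ) := by
  have log_nonneg : 0 ≤ Real.log (1 / δ) :=
    (Real.log_nonneg one_le_two).trans (log_two_le_log_one_div hδ hδ2)
  have lnTilde_ge := log_div_four_le_lnTilde ((le_one_div two_pos hδ).2 hδ2)
  have lnTilde_nonneg : 0 ≤ lnTilde (1 / δ) := by linarith
  have gaussian_term : 8 * √(n * Real.log (1 / δ)) * √v
      ≤ CRm1 * √2 * √(n * Real.log (1 / δ)) * √v := by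
    have : 8 ≤ CRm1 * √2 := by nlinarith [sixty_le_CRm1, Real.one_le_sqrt.2 one_le_two]
    gcongr
  have middle_term : 0 ≤ D1 * (n : ℝ) ^ (1 / 4 : ℝ) * (τ : ℝ) ^ (3 / 4 : ℝ) * lnTilde (1 / δ) := by
    have : 0 ≤ D1 := by
      rw [D1, CRm1]
      positivity
    positivity
  have linear_term : 144 * (1 * (8 / 3 * τ)) * Real.log (1 / δ) ≤ D2 * τ * lnTilde (1 / δ) :=
    calc 144 * (1 * (8 / 3 * τ)) * Real.log (1 / δ) = 384 * τ * Real.log (1 / δ) := by ring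
      _ ≤ 76800 * τ * (Real.log (1 / δ) / 4) := by nlinarith [mul_nonneg τ.cast_nonneg log_nonneg]
      _ ≤ D2 * τ * lnTilde (1 / δ) := by
        have D2_nonneg : 0 ≤ D2 := le_trans (by norm_num) le_D2
        gcongr
        exact le_D2
  linarith

end Constants

end MarkovBernstein

open MarkovBernstein in
theorem corollary1_general {Z : Type*} [MeasurableSpace Z] {Q : Kernel Z Z} [IsMarkovKernel Q]
    {π : Measure Z} [IsProbabilityMeasure π] {β : ℕ → ℝ} {B : ℝ} (hQ : IsSummablyMixing Q π β B)
    {f : Z → ℝ} {C : ℝ} (hf : IsBoundedMeasurable f C) (hCB : 0 < C * B) :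
    Summable (fun l => autocov Q π f (l + 1)) ∧ 0 ≤ asympVar Q π f ∧
    ∀ (ξ : Measure Z) [IsProbabilityMeasure ξ] (n : ℕ) (δ : ℝ), 0 < δ → δ ≤ 1 / 2 →
      (chainLaw Q ξ).real {ω | 8 * √(n * Real.log (1 / δ)) * √(asympVar Q π f)
          + 144 * (C * B) * Real.log (1 / δ) ≤ |centeredSum π f n ω|} ≤ δ := by
  refine ⟨hQ.summable_autocov_succ hf, hQ.asympVar_nonneg hf, fun ξ _ n δ hδ hδ2 => ?_⟩
  have log_pos : 0 < Real.log (1 / δ) :=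
    (Real.log_pos one_lt_two).trans_le (log_two_le_log_one_div hδ hδ2)
  exact (hQ.bernstein hf hCB n log_pos).trans (two_mul_exp_one_sub_le hδ hδ2)

theorem corollary1 {Z : Type*} [MetricSpace Z] [CompleteSpace Z]
    [TopologicalSpace.SeparableSpace Z] [MeasurableSpace Z] [BorelSpace Z]
    (Q : ProbabilityTheory.Kernel Z Z) [ProbabilityTheory.IsMarkovKernel Q]
    (π : MeasureTheory.Measure Z) [MeasureTheory.IsProbabilityMeasure π] (τ : ℕ)
    (hQ : MarkovBernstein.IsUniformlyErgodic Q π τ)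
    (f : Z → ℝ) (hf : Measurable f) (hf1 : ∀ z, |f z| ≤ 1) :
    Summable (fun l : ℕ => MarkovBernstein.autocov Q π f (l + 1)) ∧
    0 ≤ MarkovBernstein.asympVar Q π f ∧
    ∀ (n : ℕ) (δ : ℝ), 0 < δ → δ ≤ 1 / 2 →
      (MarkovBernstein.chainLaw Q π).real
        {ω | MarkovBernstein.CRm1 * Real.sqrt 2 * Real.sqrt (n * Real.log (1 / δ)) *
                Real.sqrt (MarkovBernstein.asympVar Q π f)
              + MarkovBernstein.D1 * (n : ℝ) ^ (1 / 4 : ℝ) * (τ : ℝ) ^ (3 / 4 : ℝ) *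
                MarkovBernstein.lnTilde (1 / δ)
              + MarkovBernstein.D2 * τ * MarkovBernstein.lnTilde (1 / δ)
            ≤ |MarkovBernstein.centeredSum π f n ω|} ≤ δ := by
  obtain ⟨summable, nonneg, tail⟩ := corollary1_general hQ.isSummablyMixing ⟨hf, hf1⟩
    (by have := hQ.tau_pos; positivity)
  exact ⟨summable, nonneg, fun n δ hδ hδ2 => (measureReal_mono fun _ hω =>
    (MarkovBernstein.bernstein_threshold_le hδ hδ2 n τ _).trans hω).trans (tail π n δ hδ hδ2)⟩
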